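/- Let $\widehat{\mathfrak{sl}}_2$ be the affine Lie algebra over $\mathbb{C}$ of type $A^{(1)}_1$, i.e. the Lie algebra with generators $e_i,f_i,h_i$ ($i\in\{0,1\}$) and the Chevalley--Serre relations of the Cartan matrix $\begin{pmatrix}2&-2\\-2&2\end{pmatrix}$, and let $\widehat{\mathfrak n}^+$ be its positive subalgebra, generated by $e_0,e_1$. Order the alphabet $\{0,1\}$ by $1<0$ and order words in it lexicographically (a proper prefix of a word is smaller than the word). A nonempty word is \emph{Lyndon} if it is smaller than all of its nontrivial cyclic permutations. The standard bracketing $\mathsf{b}[\ell]\in\widehat{\mathfrak n}^+$ of a Lyndon word $\ell$ is defined inductively by $\mathsf b[i]=e_i$ for letters $i$ and $\mathsf b[\ell]=[\mathsf b[\ell_1],\mathsf b[\ell_2]]$ if $\ell$ has length at least $2$, where $\ell=\ell_1\ell_2$ and $\ell_2$ is the longest proper suffix of $\ell$ that is a Lyndon word. A Lyndon word $\ell$ is an \emph{affine standard Lyndon word} if $\mathsf b[\ell]$ is not a linear combination of the elements $\mathsf b[m]$ for Lyndon words $m>\ell$. The degree of a word $i_1\dots i_r$ is $\alpha_{i_1}+\dots+\alpha_{i_r}\in\mathbb{N}\alpha_0\oplus\mathbb{N}\alpha_1$,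 where $\alpha_0,\alpha_1$ are the simple roots; put $\delta=\alpha_0+\alpha_1$. Write $\mathrm{SL}(\alpha)=w$ if $w$ is the one and only affine standard Lyndon word of degree $\alpha$, and let $(10)^k$ denote the word $10$ repeated $k$ times. \textbf{Proposition.} For every $k\geq 1$: $$\mathrm{SL}(k\delta+\alpha_1)=1(10)^k,\qquad \mathrm{SL}(k\delta+\alpha_0)=(10)^k0,\qquad \mathrm{SL}((k+1)\delta)=1(10)^k0.$$ For the remaining positive roots: $$\mathrm{SL}(\alpha_1)=1,\qquad \mathrm{SL}(\alpha_0)=0,\qquad \mathrm{SL}(\delta)=10.$$ Moreover, these are all the affine standard Lyndon words for $\widehat{\mathfrak{sl}}_2$ with the order $1<0$. -/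

import Mathlib

namespace AffineLyndon

section Words

variable {I : Type*} [LinearOrder I]

/-- A word in the ordered alphabet `I` is a `List I`; the order `<` on `List I` is the
lexicographic one, in which a proper prefix of a word is smaller than the word.
A nonempty word is Lyndon if it is smaller than all of its nontrivial cyclic permutations. -/
def IsLyndon (w : List I) : Prop :=
  w ≠ [] ∧ ∀ u v : List I, u ≠ [] → v ≠ [] → w = u ++ v → w < v ++ u

theorem isLyndon_singleton (i : I) : IsLyndon [i] := by
  refine ⟨by simp, ?_⟩
  intro u v hu hv h
  have := congrArg List.length h
  have h1 := List.length_pos_iff.2 hu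
  have h2 := List.length_pos_iff.2 hv
  simp at this
  omega

/-- `a` is the length of a proper nonempty prefix of `w` whose complementary suffix is Lyndon. -/
def IsLyndonCut (w : List I) (a : ℕ) : Prop :=
  0 < a ∧ a < w.length ∧ IsLyndon (w.drop a)

theorem exists_isLyndonCut {w : List I} (hw : 2 ≤ w.length) : ∃ a, IsLyndonCut w a := by
  refine ⟨w.length - 1, by omega, by omega, ?_⟩
  obtain ⟨i, hi⟩ : ∃ i, w.drop (w.length - 1) = [i] :=
    List.length_eq_one_iff.1 (by rw [List.length_drop]; omega)
  rw [hi]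
  exact isLyndon_singleton i

open Classical in
/-- The cut of the costandard factorization `w = (w.take a) ++ (w.drop a)`: the least `a` as
above, so that `w.drop a` is the longest proper suffix of `w` that is Lyndon. -/
noncomputable def costandardCut (w : List I) (hw : 2 ≤ w.length) : ℕ :=
  Nat.find (exists_isLyndonCut hw)

theorem costandardCut_spec (w : List I) (hw : 2 ≤ w.length) :
    IsLyndonCut w (costandardCut w hw) := by
  classical
  unfold costandardCut
  convert Nat.find_spec (exists_isLyndonCut hw)

theorem costandardCut_le (w : List I) (hw : 2 ≤ w.length) (a : ℕ) (ha : IsLyndonCut w a) :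
    costandardCut w hw ≤ a := by
  classical
  unfold costandardCut
  convert Nat.find_min' (exists_isLyndonCut hw) ha

/-- The degree `α_{i₁} + ⋯ + α_{iₖ}` of a word `[i₁ … iₖ]`, in `Q⁺ = ⨁ᵢ ℕ αᵢ`. -/
noncomputable def degree (w : List I) : I →₀ ℕ :=
  (w.map fun i => Finsupp.single i 1).sum

variable {L : Type*} [LieRing L]

/-- The standard bracketing of a Lyndon word, for elements `e i` of a Lie algebra:
`b[i] = e i` and `b[ℓ] = ⁅b[ℓ₁], b[ℓ₂]⁆` for the costandard factorization `ℓ = ℓ₁ ℓ₂`.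
(It is only used on Lyndon words; on the empty word it is `0`.) -/
noncomputable def bracketing (e : I → L) : List I → L
  | [] => 0
  | [i] => e i
  | i :: j :: t =>
    have := costandardCut_spec (i :: j :: t) (by simp)
    ⁅bracketing e ((i :: j :: t).take (costandardCut (i :: j :: t) (by simp))),
      bracketing e ((i :: j :: t).drop (costandardCut (i :: j :: t) (by simp)))⁆
termination_by w => w.length
decreasing_by
  · have h := this.2.1
    rw [List.length_take]
    omega
  · have h := this.1
    have h' := this.2.1
    rw [List.length_drop]
    omega

/-- A Lyndon word `ℓ` is standard Lyndon, with respect to the generators `e i` of a Lie algebra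
over `R`, if `b[ℓ]` is not a linear combination of `b[m]` for Lyndon words `m > ℓ`. -/
def IsStandardLyndon (R : Type*) [CommRing R] [LieAlgebra R L] (e : I → L) (w : List I) : Prop :=
  IsLyndon w ∧ bracketing e w ∉ Submodule.span R (bracketing e '' {m | IsLyndon m ∧ w < m})

end Words

section AffineSl2

/-- The Cartan matrix of type `A₁⁽¹⁾`, with rows and columns indexed by `0, 1`. -/
def cartanMatrix : Matrix (Fin 2) (Fin 2) ℤ := !![2, -2; -2, 2]

/-- The affine Lie algebra of type `A₁⁽¹⁾` over `ℂ`: generators `eᵢ`, `fᵢ`, `hᵢ` for `i = 0, 1`,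
and the Chevalley-Serre relations of the affine Cartan matrix. -/
abbrev AffineSl2 : Type := Matrix.ToLieAlgebra ℂ cartanMatrix

/-- The Chevalley generator `eᵢ` of the affine Lie algebra. -/
noncomputable def chevalleyE (i : Fin 2) : AffineSl2 :=
  LieSubmodule.Quotient.mk (N := CartanMatrix.Relations.toIdeal ℂ cartanMatrix)
    (FreeLieAlgebra.of ℂ (CartanMatrix.Generators.E i))

/-- The positive subalgebra of the affine Lie algebra, generated by `e₀` and `e₁`. -/
noncomputable def nPlus : LieSubalgebra ℂ AffineSl2 :=
  LieSubalgebra.lieSpan ℂ AffineSl2 (Set.range chevalleyE)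

/-- The alphabet `{0, 1}` with the order reversed, so that `1 < 0`. -/
abbrev Letter : Type := (Fin 2)ᵒᵈ

/-- The letter `0`. -/
def zero : Letter := OrderDual.toDual 0

/-- The letter `1`. -/
def one : Letter := OrderDual.toDual 1

theorem one_lt_zero : one < zero := by decide

/-- The generator `eᵢ` of the positive subalgebra. -/
noncomputable def gen (i : Letter) : nPlus :=
  ⟨chevalleyE (OrderDual.ofDual i),
    LieSubalgebra.subset_lieSpan (Set.mem_range_self (OrderDual.ofDual i))⟩

/-- Affine standard Lyndon words, for the affinization of `sl₂` and the order `1 < 0`. -/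
def IsAffineStandardLyndon (w : List Letter) : Prop := IsStandardLyndon ℂ gen w

/-- The set of all affine standard Lyndon words of degree `α`. The equation `slWords α = {w}`
says that there is exactly one such word, `w`, that is `SL(α) = w`. -/
def slWords (α : Letter →₀ ℕ) : Set (List Letter) :=
  {w | IsAffineStandardLyndon w ∧ degree w = α}

/-- The simple root `α₀`. -/
noncomputable def α₀ : Letter →₀ ℕ := Finsupp.single zero 1

/-- The simple root `α₁`. -/
noncomputable def α₁ : Letter →₀ ℕ := Finsupp.single one 1

/-- The minimal imaginary root. -/
noncomputable def δ : Letter →₀ ℕ := α₀ + α₁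

/-- The word `10 10 ⋯ 10`, with `10` repeated `k` times. -/
def tens (k : ℕ) : List Letter := (List.replicate k [one, zero]).flatten

end AffineSl2

end AffineLyndon

/-! Every root space of the positive subalgebra is at most one-dimensional, and a standard
bracketing is homogeneous. Hence the standard Lyndon word of a degree is the largest Lyndon word of
that degree with nonzero bracketing, and degrees with no such word have no standard Lyndon word. The
task is to compute this maximum.

The loop algebra of `sl₂`, with `e₁` mapped to `E` and `e₀` to `tF`, makes bracketings computable.
The Serre relations bound the positive subalgebra by a span of root vectors whose images are
independent, so nothing is lost (`eq_zero_of_loopHom_eq_zero`).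

The upper bound `le_standardWord` is an induction along the costandard factorization `w = uv`: both
factors are Lyndon, have nonzero bracketing and satisfy `u < v`, and `append_le_standardWord`
combines their bounds. The bound is attained because the bracketings of the candidate words are
powers of `-2` times root vectors. `isAffineStandardLyndon_iff` puts the two halves together. -/

namespace AffineLyndon

/-! ### Consequences of the Serre relations: a spanning set of root vectors -/

section SerreSpan

variable {K L : Type*} [Field K] [LieRing L] [LieAlgebra K L]

/-- The bracket relations which the two Serre relations of `A₁⁽¹⁾` force on the root vectors. -/
theorem serre_bracket_relations [CharZero K] (E F : ℕ → L)
    (hE : ∀ k, ⁅⁅E 0, F 0⁆, E k⁆ = (2 : K) • E (k + 1))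
    (hF : ∀ k, ⁅⁅E 0, F 0⁆, F k⁆ = (-2 : K) • F (k + 1))
    (serreE : ⁅E 0, ⁅E 0, ⁅E 0, F 0⁆⁆⁆ = 0) (serreF : ⁅F 0, ⁅F 0, ⁅F 0, E 0⁆⁆⁆ = 0) (n : ℕ) :
    (∀ i j, i + j = n → ⁅E i, F j⁆ = ⁅E n, F 0⁆) ∧
      ⁅⁅E n, F 0⁆, E 0⁆ = (2 : K) • E (n + 1) ∧ ⁅⁅E n, F 0⁆, F 0⁆ = (-2 : K) • F (n + 1) ∧
      ⁅E 0, E (n + 1)⁆ = 0 ∧ ⁅F 0, F (n + 1)⁆ = 0 := by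
  have two : (2 : K) ≠ 0 := two_ne_zero
  have serreE' : ⁅E 0, E 1⁆ = 0 := by
    have h1 := hE 0
    rw [← lie_skew] at h1
    have h2 : (2 : K) • ⁅E 0, E 1⁆ = 0 := by
      rw [← lie_smul, ← h1, lie_neg, serreE, neg_zero]
    exact (smul_eq_zero.1 h2).resolve_left two
  have serreF' : ⁅F 0, F 1⁆ = 0 := by
    have h1 := hF 0
    rw [← lie_skew, ← lie_skew (E 0) (F 0), lie_neg, neg_neg] at h1
    have h2 : (-2 : K) • ⁅F 0, F 1⁆ = 0 := by
      rw [← lie_smul, ← h1, serreF]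
    exact (smul_eq_zero.1 h2).resolve_left (neg_ne_zero.2 two)
  induction n with
  | zero =>
    refine ⟨?_, hE 0, hF 0, serreE', serreF'⟩
    intro i j hij
    obtain ⟨rfl, rfl⟩ : i = 0 ∧ j = 0 := by omega
    rfl
  | succ n ih =>
    obtain ⟨hP, hQE, hQF, hRE, hRF⟩ := ih
    set h := ⁅E 0, F 0⁆ with hh
    set k := ⁅h, ⁅E n, F 0⁆⁆ with hk
    -- Applying `ad h` to `⁅E i, F j⁆`, which is independent of the splitting `i + j = n`, shows
    -- that moving one unit of degree from `E` to `F` costs exactly `k`.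
    have step : ∀ i j, i + j = n → (2 : K) • ⁅E i, F (j + 1)⁆ = (2 : K) • ⁅E (i + 1), F j⁆ - k := by
      intro i j hij
      have h1 : k = ⁅⁅h, E i⁆, F j⁆ + ⁅E i, ⁅h, F j⁆⁆ := by rw [hk, ← hP i j hij, leibniz_lie]
      rw [hE, hF, smul_lie, lie_smul] at h1
      rw [h1]
      module
    have steps : ∀ s i, i + s = n + 1 →
        (2 : K) • ⁅E i, F s⁆ = (2 : K) • ⁅E (n + 1), F 0⁆ - (s : K) • k := by
      intro s
      induction s with
      | zero =>
        intro i hi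
        obtain rfl : i = n + 1 := by omega
        simp
      | succ s ihs =>
        intro i hi
        rw [step i s (by omega), ihs (i + 1) (by omega)]
        push_cast
        module
    -- Applying `ad (F 0)` to `⁅⁅E n, F 0⁆, E 0⁆` gives `2⁅E 0, F (n+1)⁆ = 2⁅E (n+1), F 0⁆ + k`,
    -- whereas `steps` has `-(n+1)k` in place of `k`. So `(n+2)k = 0`.
    have hk0 : k = 0 := by
      have h1 : ⁅F 0, ⁅⁅E n, F 0⁆, E 0⁆⁆ = ⁅⁅F 0, ⁅E n, F 0⁆⁆, E 0⁆ + ⁅⁅E n, F 0⁆, ⁅F 0, E 0⁆⁆ :=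
        leibniz_lie _ _ _
      have h2 : ⁅⁅E n, F 0⁆, ⁅F 0, E 0⁆⁆ = k := by
        rw [← lie_skew (F 0) (E 0), lie_neg, lie_skew]
      have h3 : ⁅⁅F 0, ⁅E n, F 0⁆⁆, E 0⁆ = (-2 : K) • ⁅E 0, F (n + 1)⁆ := by
        rw [← lie_skew (F 0), hQF, neg_lie, smul_lie, ← lie_skew]
        module
      have h4 : ⁅F 0, ⁅⁅E n, F 0⁆, E 0⁆⁆ = (-2 : K) • ⁅E (n + 1), F 0⁆ := by
        rw [hQE, lie_smul, ← lie_skew]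
        module
      rw [h2, h3, h4] at h1
      have h5 := steps (n + 1) 0 (by omega)
      have h6 : ((n + 2 : ℕ) : K) • k = 0 := by
        push_cast at h5 ⊢
        linear_combination (norm := module) -h1 + h5
      exact (smul_eq_zero.1 h6).resolve_left (by exact_mod_cast (by omega : n + 2 ≠ 0))
    have hP' : ∀ i j, i + j = n + 1 → ⁅E i, F j⁆ = ⁅E (n + 1), F 0⁆ := by
      intro i j hij
      have h1 := steps j i hij
      rw [hk0, smul_zero, sub_zero] at h1
      exact smul_right_injective L two h1
    have hQE' : ⁅⁅E (n + 1), F 0⁆, E 0⁆ = (2 : K) • E (n + 2) := by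
      have h1 : ⁅F 0, ⁅E 0, E (n + 1)⁆⁆ = ⁅⁅F 0, E 0⁆, E (n + 1)⁆ + ⁅E 0, ⁅F 0, E (n + 1)⁆⁆ :=
        leibniz_lie _ _ _
      rw [hRE, lie_zero, ← lie_skew (F 0) (E 0), neg_lie, ← hh, hE, ← lie_skew (F 0) (E (n + 1)),
        lie_neg, lie_skew] at h1
      linear_combination (norm := module) -h1
    have hQF' : ⁅⁅E (n + 1), F 0⁆, F 0⁆ = (-2 : K) • F (n + 2) := by
      have h1 : ⁅E 0, ⁅F 0, F (n + 1)⁆⁆ = ⁅⁅E 0, F 0⁆, F (n + 1)⁆ + ⁅F 0, ⁅E 0, F (n + 1)⁆⁆ :=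
        leibniz_lie _ _ _
      rw [hRF, lie_zero, hF, hP' 0 (n + 1) (by omega), ← lie_skew (F 0)] at h1
      linear_combination (norm := module) h1
    have hcomm : ∀ m : L, ⁅⁅E n, F 0⁆, ⁅h, m⁆⁆ = ⁅h, ⁅⁅E n, F 0⁆, m⁆⁆ := by
      intro m
      rw [leibniz_lie h, ← hk, hk0, zero_lie, zero_add]
    refine ⟨hP', hQE', hQF', ?_, ?_⟩
    -- Two expressions for `⁅E 0, E (n+2)⁆`, from `ad ⁅E n, F 0⁆` on `⁅E 0, E 1⁆ = 0` and `ad h` on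
    -- `⁅E 0, E (n+1)⁆ = 0`, differ by the sign of `⁅E 1, E (n+1)⁆`; their sum eliminates it.
    · have h1 : ⁅⁅E n, F 0⁆, E 1⁆ = (2 : K) • E (n + 2) := by
        have := hcomm (E 0)
        rw [hE, hQE, lie_smul, lie_smul, hE] at this
        exact smul_right_injective L two this
      have h2 : ⁅⁅E n, F 0⁆, ⁅E 0, E 1⁆⁆ = ⁅⁅⁅E n, F 0⁆, E 0⁆, E 1⁆ + ⁅E 0, ⁅⁅E n, F 0⁆, E 1⁆⁆ :=
        leibniz_lie _ _ _
      rw [serreE', lie_zero, hQE, h1, smul_lie, lie_smul, ← lie_skew] at h2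
      have h3 : ⁅h, ⁅E 0, E (n + 1)⁆⁆ = ⁅⁅h, E 0⁆, E (n + 1)⁆ + ⁅E 0, ⁅h, E (n + 1)⁆⁆ :=
        leibniz_lie _ _ _
      rw [hRE, lie_zero, hE, hE, smul_lie, lie_smul] at h3
      have h4 : (4 : K) • ⁅E 0, E (n + 2)⁆ = 0 := by
        linear_combination (norm := module) -h2 - h3
      exact (smul_eq_zero.1 h4).resolve_left (OfNat.ofNat_ne_zero 4)
    · have h1 : ⁅⁅E n, F 0⁆, F 1⁆ = (-2 : K) • F (n + 2) := by
        have := hcomm (F 0)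
        rw [hF, hQF, lie_smul, lie_smul, hF] at this
        exact smul_right_injective L (neg_ne_zero.2 two) this
      have h2 : ⁅⁅E n, F 0⁆, ⁅F 0, F 1⁆⁆ = ⁅⁅⁅E n, F 0⁆, F 0⁆, F 1⁆ + ⁅F 0, ⁅⁅E n, F 0⁆, F 1⁆⁆ :=
        leibniz_lie _ _ _
      rw [serreF', lie_zero, hQF, h1, smul_lie, lie_smul, ← lie_skew] at h2
      have h3 : ⁅h, ⁅F 0, F (n + 1)⁆⁆ = ⁅⁅h, F 0⁆, F (n + 1)⁆ + ⁅F 0, ⁅h, F (n + 1)⁆⁆ :=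
        leibniz_lie _ _ _
      rw [hRF, lie_zero, hF, hF, smul_lie, lie_smul] at h3
      have h4 : (4 : K) • ⁅F 0, F (n + 2)⁆ = 0 := by
        linear_combination (norm := module) h2 + h3
      exact (smul_eq_zero.1 h4).resolve_left (OfNat.ofNat_ne_zero 4)

/-- A subspace that contains the generators and is stable under bracketing with them contains the
Lie subalgebra they generate. -/
theorem lieSpan_le_of_forall_lie_mem {s : Set L} (S : Submodule K L) (hs : s ⊆ S)
    (h : ∀ x ∈ s, ∀ z ∈ S, ⁅x, z⁆ ∈ S) {x : L} (hx : x ∈ LieSubalgebra.lieSpan K L s) : x ∈ S := by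
  -- The strengthened property survives brackets by the Jacobi identity; membership in `S` alone
  -- would not.
  suffices hx' : x ∈ S ∧ ∀ z ∈ S, ⁅x, z⁆ ∈ S from hx'.1
  induction hx using LieSubalgebra.lieSpan_induction with
  | mem x hx => exact ⟨hs hx, h x hx⟩
  | zero => exact ⟨S.zero_mem, fun z _ => by simp⟩
  | smul a x _ ih =>
    exact ⟨S.smul_mem a ih.1, fun z hz => by rw [smul_lie]; exact S.smul_mem a (ih.2 z hz)⟩
  | add x y _ _ ihx ihy =>
    exact ⟨S.add_mem ihx.1 ihy.1,
      fun z hz => by rw [add_lie]; exact S.add_mem (ihx.2 z hz) (ihy.2 z hz)⟩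
  | lie x y _ _ ihx ihy =>
    refine ⟨ihx.2 y ihy.1, fun z hz => ?_⟩
    rw [lie_lie]
    exact S.sub_mem (ihx.2 _ (ihy.2 z hz)) (ihy.2 _ (ihx.2 z hz))

/-- The root vectors span the Lie algebra generated by two elements with the Serre relations. -/
theorem lieSpan_le_span_rootVectors [CharZero K] (E F : ℕ → L)
    (hE : ∀ k, ⁅⁅E 0, F 0⁆, E k⁆ = (2 : K) • E (k + 1))
    (hF : ∀ k, ⁅⁅E 0, F 0⁆, F k⁆ = (-2 : K) • F (k + 1))
    (serreE : ⁅E 0, ⁅E 0, ⁅E 0, F 0⁆⁆⁆ = 0) (serreF : ⁅F 0, ⁅F 0, ⁅F 0, E 0⁆⁆⁆ = 0) {x : L}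
    (hx : x ∈ LieSubalgebra.lieSpan K L {E 0, F 0}) :
    x ∈ Submodule.span K
      (Set.range (Sum.elim E (Sum.elim F fun n => ⁅E n, F 0⁆) : ℕ ⊕ ℕ ⊕ ℕ → L)) := by
  set v : ℕ ⊕ ℕ ⊕ ℕ → L := Sum.elim E (Sum.elim F fun n => ⁅E n, F 0⁆) with hv
  have mE : ∀ k, E k ∈ Submodule.span K (Set.range v) :=
    fun k => Submodule.subset_span ⟨Sum.inl k, rfl⟩
  have mF : ∀ k, F k ∈ Submodule.span K (Set.range v) :=
    fun k => Submodule.subset_span ⟨Sum.inr (Sum.inl k), rfl⟩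
  have mH : ∀ k, ⁅E k, F 0⁆ ∈ Submodule.span K (Set.range v) :=
    fun k => Submodule.subset_span ⟨Sum.inr (Sum.inr k), rfl⟩
  have key := serre_bracket_relations (K := K) E F hE hF serreE serreF
  refine lieSpan_le_of_forall_lie_mem _ ?_ ?_ hx
  · rintro _ (rfl | rfl)
    exacts [mE 0, mF 0]
  · intro y hy z hz
    induction hz using Submodule.span_induction with
    | zero => simp
    | add a b _ _ ha hb => rw [lie_add]; exact Submodule.add_mem _ ha hb
    | smul c a _ ha => rw [lie_smul]; exact Submodule.smul_mem _ c ha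
    | mem z hz =>
      obtain ⟨k | k | k, rfl⟩ := hz <;> simp only [hv, Sum.elim_inl, Sum.elim_inr] <;>
        rcases hy with rfl | rfl
      · cases k with
        | zero => simp
        | succ k => rw [(key k).2.2.2.1]; exact Submodule.zero_mem _
      · rw [← lie_skew]; exact Submodule.neg_mem _ (mH k)
      · rw [(key k).1 0 k (by omega)]; exact mH k
      · cases k with
        | zero => simp
        | succ k => rw [(key k).2.2.2.2]; exact Submodule.zero_mem _
      · rw [← lie_skew, (key k).2.1]; exact Submodule.neg_mem _ (Submodule.smul_mem _ _ (mE _))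
      · rw [← lie_skew, (key k).2.2.1]; exact Submodule.neg_mem _ (Submodule.smul_mem _ _ (mF _))

end SerreSpan

/-! ### The loop algebra of `sl₂` and the embedding of the positive subalgebra -/

section LoopAlgebra

open LaurentPolynomial

attribute [local instance] LieRing.ofAssociativeRing

/-- A Lie algebra homomorphism from the Lie algebra of a Cartan matrix, given by images of the
generators that satisfy the Chevalley-Serre relations. -/
noncomputable def liftToLieAlgebra {R B L : Type*} [CommRing R] [DecidableEq B] (A : Matrix B B ℤ)
    [LieRing L] [LieAlgebra R L] (g : CartanMatrix.Generators B → L)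
    (hg : ∀ x ∈ CartanMatrix.Relations.toSet R A, FreeLieAlgebra.lift R g x = 0) :
    Matrix.ToLieAlgebra R A →ₗ⁅R⁆ L :=
  { Submodule.liftQ (CartanMatrix.Relations.toIdeal R A).toSubmodule
      (FreeLieAlgebra.lift R g : FreeLieAlgebra R (CartanMatrix.Generators B) →ₗ[R] L) (by
        intro x hx
        have : CartanMatrix.Relations.toIdeal R A ≤ (FreeLieAlgebra.lift R g).ker :=
          LieSubmodule.lieSpan_le.2 fun y hy => LieHom.mem_ker.2 (hg y hy)
        exact LieHom.mem_ker.1 (this hx)) with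
    map_lie' := by
      rintro ⟨x⟩ ⟨y⟩
      exact LieHom.map_lie (FreeLieAlgebra.lift R g) x y }

theorem liftToLieAlgebra_mk {R B L : Type*} [CommRing R] [DecidableEq B] (A : Matrix B B ℤ)
    [LieRing L] [LieAlgebra R L] (g : CartanMatrix.Generators B → L)
    (hg : ∀ x ∈ CartanMatrix.Relations.toSet R A, FreeLieAlgebra.lift R g x = 0)
    (x : FreeLieAlgebra R (CartanMatrix.Generators B)) :
    liftToLieAlgebra A g hg
      (LieSubmodule.Quotient.mk (N := CartanMatrix.Relations.toIdeal R A) x) =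
        FreeLieAlgebra.lift R g x := rfl

/-- The Chevalley generators of the loop algebra of `sl₂`. -/
noncomputable def loopGenerators : CartanMatrix.Generators (Fin 2) → Matrix (Fin 2) (Fin 2) ℂ[T;T⁻¹]
  | .H i => if i = 0 then !![-1, 0; 0, 1] else !![1, 0; 0, -1]
  | .E i => if i = 0 then !![0, 0; T 1, 0] else !![0, 1; 0, 0]
  | .F i => if i = 0 then !![0, T (-1); 0, 0] else !![0, 0; 1, 0]

/-- All relations are entrywise matrix identities. The central element `h₀ + h₁` is sent to zero,
which is harmless: only injectivity on the positive subalgebra is needed. -/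
theorem lift_loopGenerators_eq_zero :
    ∀ x ∈ CartanMatrix.Relations.toSet ℂ cartanMatrix,
      FreeLieAlgebra.lift ℂ loopGenerators x = 0 := by
  have h2 : (2 : ℤ).toNat = 2 := rfl
  have h3 : (-2 : ℤ).toNat = 0 := rfl
  have hT : (T 1 * T (-1) : ℂ[T;T⁻¹]) = 1 := by rw [← T_add]; simp
  have hT' : (T (-1) * T 1 : ℂ[T;T⁻¹]) = 1 := by rw [← T_add]; simp
  intro x hx
  simp only [CartanMatrix.Relations.toSet, Set.mem_union, Set.mem_range, Prod.exists] at hx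
  rcases hx with ((((⟨i, j, rfl⟩ | ⟨i, j, rfl⟩) | ⟨i, j, rfl⟩) | ⟨i, j, rfl⟩) | ⟨i, j, rfl⟩) |
    ⟨i, j, rfl⟩ <;> fin_cases i <;> fin_cases j <;>
  simp [CartanMatrix.Relations.HH, CartanMatrix.Relations.EF, CartanMatrix.Relations.HE,
    CartanMatrix.Relations.HF, CartanMatrix.Relations.adE, CartanMatrix.Relations.adF,
    cartanMatrix, h2, h3, pow_succ, FreeLieAlgebra.lift_of_apply, loopGenerators,
    LieRing.of_associative_ring_bracket, hT, hT', two_mul] <;>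
  (try ext i j : 1; fin_cases i <;> fin_cases j <;> simp) <;> ring

/-- The homomorphism from the affine Lie algebra to the loop algebra of `sl₂`. -/
noncomputable def loopHom : AffineSl2 →ₗ⁅ℂ⁆ Matrix (Fin 2) (Fin 2) ℂ[T;T⁻¹] :=
  liftToLieAlgebra cartanMatrix loopGenerators lift_loopGenerators_eq_zero

/-- The root vector of the loop algebra of `sl₂` in degree `p α₁ + q α₀`, zero if this degree is
not a root. -/
noncomputable def loopRoot (p q : ℕ) : Matrix (Fin 2) (Fin 2) ℂ[T;T⁻¹] :=
  if p = q + 1 then !![0, T q; 0, 0] else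
  if q = p + 1 then !![0, 0; T q, 0] else
  if p = q then !![T q, 0; 0, -T q] else 0

theorem loopRoot_succ_left (q : ℕ) : loopRoot (q + 1) q = !![0, T q; 0, 0] := by simp [loopRoot]

theorem loopRoot_succ_right (p : ℕ) : loopRoot p (p + 1) = !![0, 0; T (p + 1), 0] := by
  simp only [loopRoot, if_neg (show p ≠ p + 1 + 1 by omega), if_true]
  push_cast
  rfl

theorem loopRoot_self (q : ℕ) : loopRoot q q = !![T q, 0; 0, -T q] := by
  simp [loopRoot]

theorem loopRoot_eq_zero {p q : ℕ} (h1 : p ≠ q + 1) (h2 : q ≠ p + 1) (h3 : p ≠ q) :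
    loopRoot p q = 0 := by
  simp [loopRoot, h1, h2, h3]

theorem loopHom_chevalleyE_one : loopHom (chevalleyE 1) = loopRoot 1 0 := by
  simp [loopHom, chevalleyE, liftToLieAlgebra_mk, FreeLieAlgebra.lift_of_apply, loopGenerators,
    loopRoot]

theorem loopHom_chevalleyE_zero : loopHom (chevalleyE 0) = loopRoot 0 1 := by
  simp [loopHom, chevalleyE, liftToLieAlgebra_mk, FreeLieAlgebra.lift_of_apply, loopGenerators,
    loopRoot]

theorem chevalleyE_serre (i j : Fin 2) (h : i ≠ j) :
    ⁅chevalleyE i, ⁅chevalleyE i, ⁅chevalleyE i, chevalleyE j⁆⁆⁆ = 0 := by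
  have h1 : CartanMatrix.Relations.adE ℂ cartanMatrix (i, j) ∈
      CartanMatrix.Relations.toIdeal ℂ cartanMatrix :=
    LieSubmodule.subset_lieSpan (Or.inl (Or.inr ⟨_, rfl⟩))
  have h2 := (LieSubmodule.Quotient.mk_eq_zero' (R := ℂ)).2 h1
  have h3 : (-cartanMatrix i j).toNat = 2 := by
    fin_cases i <;> fin_cases j <;> first | exact absurd rfl h | rfl
  simp only [CartanMatrix.Relations.adE, Function.uncurry, h3] at h2
  exact h2

theorem loopRoot_lie_simple : ⁅loopRoot 1 0, loopRoot 0 1⁆ = loopRoot 1 1 := by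
  rw [loopRoot_succ_left 0, loopRoot_succ_right 0, loopRoot_self]
  simp [LieRing.of_associative_ring_bracket]

theorem T_natCast_add (m k : ℕ) : (T ((m + k : ℕ) : ℤ) : ℂ[T;T⁻¹]) = T m * T k := by
  rw [Nat.cast_add, T_add]

theorem loopRoot_lie_self_left (m k : ℕ) :
    ⁅loopRoot m m, loopRoot (k + 1) k⁆ = (2 : ℂ) • loopRoot (m + k + 1) (m + k) := by
  rw [loopRoot_succ_left, loopRoot_succ_left, loopRoot_self, T_natCast_add]
  generalize (T m : ℂ[T;T⁻¹]) = a
  generalize (T k : ℂ[T;T⁻¹]) = b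
  ext i j : 1
  fin_cases i <;> fin_cases j <;> simp [LieRing.of_associative_ring_bracket, two_smul]
  ring

theorem loopRoot_lie_self_right (m k : ℕ) :
    ⁅loopRoot m m, loopRoot k (k + 1)⁆ = (-2 : ℂ) • loopRoot (m + k) (m + k + 1) := by
  rw [loopRoot_succ_right, loopRoot_succ_right, loopRoot_self]
  have h : (T (((m + k : ℕ) : ℤ) + 1) : ℂ[T;T⁻¹]) = T m * T (k + 1) := by
    rw [← T_add]; congr 1
  rw [h]
  generalize (T m : ℂ[T;T⁻¹]) = a
  generalize (T (k + 1) : ℂ[T;T⁻¹]) = b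
  ext i j : 1
  fin_cases i <;> fin_cases j <;> simp [LieRing.of_associative_ring_bracket, two_smul]
  ring

theorem loopRoot_lie_left_right (k m : ℕ) :
    ⁅loopRoot (k + 1) k, loopRoot m (m + 1)⁆ = loopRoot (k + m + 1) (k + m + 1) := by
  rw [loopRoot_succ_right, loopRoot_succ_left, loopRoot_self]
  have h : (T ((k + m + 1 : ℕ) : ℤ) : ℂ[T;T⁻¹]) = T k * T (m + 1) := by
    rw [← T_add]; congr 1
  rw [h]
  generalize (T k : ℂ[T;T⁻¹]) = a
  generalize (T (m + 1) : ℂ[T;T⁻¹]) = b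
  ext i j : 1
  fin_cases i <;> fin_cases j <;> simp [LieRing.of_associative_ring_bracket, mul_comm]

theorem loopRoot_lie_left_left (k m : ℕ) : ⁅loopRoot (k + 1) k, loopRoot (m + 1) m⁆ = 0 := by
  rw [loopRoot_succ_left, loopRoot_succ_left]
  simp [LieRing.of_associative_ring_bracket]

theorem loopRoot_lie_right_right (k m : ℕ) : ⁅loopRoot k (k + 1), loopRoot m (m + 1)⁆ = 0 := by
  rw [loopRoot_succ_right, loopRoot_succ_right]
  simp [LieRing.of_associative_ring_bracket]

theorem loopRoot_lie_self_self (k m : ℕ) : ⁅loopRoot k k, loopRoot m m⁆ = 0 := by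
  rw [loopRoot_self, loopRoot_self]
  generalize (T k : ℂ[T;T⁻¹]) = a
  generalize (T m : ℂ[T;T⁻¹]) = b
  ext i j : 1
  fin_cases i <;> fin_cases j <;> simp [LieRing.of_associative_ring_bracket, mul_comm]

/-- The bracket of two root vectors lies in the sum of their degrees, and it vanishes unless the
differences `p - q` and `p' - q'` are distinct. -/
theorem loopRoot_lie (p q p' q' : ℕ) :
    (∃ c : ℂ, ⁅loopRoot p q, loopRoot p' q'⁆ = c • loopRoot (p + p') (q + q')) ∧
      (⁅loopRoot p q, loopRoot p' q'⁆ ≠ 0 → p + q' ≠ q + p') := by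
  by_cases h : p ≠ q + 1 ∧ q ≠ p + 1 ∧ p ≠ q
  · rw [loopRoot_eq_zero h.1 h.2.1 h.2.2, zero_lie]
    exact ⟨⟨0, by simp⟩, by simp⟩
  by_cases h' : p' ≠ q' + 1 ∧ q' ≠ p' + 1 ∧ p' ≠ q'
  · rw [loopRoot_eq_zero h'.1 h'.2.1 h'.2.2, lie_zero]
    exact ⟨⟨0, by simp⟩, by simp⟩
  have h1 : p = q + 1 ∨ q = p + 1 ∨ p = q := by tauto
  have h2 : p' = q' + 1 ∨ q' = p' + 1 ∨ p' = q' := by tauto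
  rcases h1 with rfl | rfl | rfl <;> rcases h2 with rfl | rfl | rfl
  · rw [loopRoot_lie_left_left]
    exact ⟨⟨0, by simp⟩, by simp⟩
  · rw [loopRoot_lie_left_right]
    exact ⟨⟨1, by rw [one_smul]; congr 1; omega⟩, fun _ => by omega⟩
  · rw [← lie_skew, loopRoot_lie_self_left, ← neg_smul]
    exact ⟨⟨_, by congr 2 <;> omega⟩, fun _ => by omega⟩
  · rw [← lie_skew, loopRoot_lie_left_right]
    exact ⟨⟨-1, by rw [neg_one_smul]; congr 2 <;> omega⟩, fun _ => by omega⟩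
  · rw [loopRoot_lie_right_right]
    exact ⟨⟨0, by simp⟩, by simp⟩
  · rw [← lie_skew, loopRoot_lie_self_right, ← neg_smul]
    exact ⟨⟨_, by congr 2 <;> omega⟩, fun _ => by omega⟩
  · rw [loopRoot_lie_self_left]
    exact ⟨⟨_, by congr 2⟩, fun _ => by omega⟩
  · rw [loopRoot_lie_self_right]
    exact ⟨⟨_, by congr 2⟩, fun _ => by omega⟩
  · rw [loopRoot_lie_self_self]
    exact ⟨⟨0, by simp⟩, by simp⟩

/-- A linear form on the loop algebra that picks out the degree `p α₁ + q α₀`. -/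
noncomputable def loopCoeff (p q : ℕ) : Matrix (Fin 2) (Fin 2) ℂ[T;T⁻¹] →ₗ[ℂ] ℂ :=
  Finsupp.lapply (q : ℤ) ∘ₗ (AddMonoidAlgebra.coeffLinearEquiv ℂ).toLinearMap ∘ₗ
    -- The entry is `(0, 1)` for `p = q + 1`, `(1, 0)` for `q = p + 1` and `(0, 0)` for `p = q`.
    Matrix.entryLinearMap ℂ ℂ[T;T⁻¹] (if q < p + 1 then 0 else 1) (if p < q + 1 then 0 else 1)

theorem loopCoeff_apply (p q : ℕ) (M : Matrix (Fin 2) (Fin 2) ℂ[T;T⁻¹]) :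
    loopCoeff p q M = (M (if q < p + 1 then 0 else 1) (if p < q + 1 then 0 else 1)).coeff q := rfl

theorem loopCoeff_loopRoot_ne {p q p' q' : ℕ} (hr : p = q + 1 ∨ q = p + 1 ∨ p = q)
    (h : (p, q) ≠ (p', q')) : loopCoeff p q (loopRoot p' q') = 0 := by
  by_cases h' : p' ≠ q' + 1 ∧ q' ≠ p' + 1 ∧ p' ≠ q'
  · rw [loopRoot_eq_zero h'.1 h'.2.1 h'.2.2, map_zero]
  have h2 : p' = q' + 1 ∨ q' = p' + 1 ∨ p' = q' := by tauto
  rw [loopCoeff_apply]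
  rcases h2 with rfl | rfl | rfl <;> rcases hr with rfl | rfl | rfl <;>
    simp [loopRoot_succ_right, loopRoot_succ_left, loopRoot_self] at h ⊢ <;> omega

theorem loopCoeff_loopRoot_self {p q : ℕ} (h : p = q + 1 ∨ q = p + 1 ∨ p = q) :
    loopCoeff p q (loopRoot p q) = 1 := by
  rw [loopCoeff_apply]
  rcases h with rfl | rfl | rfl <;>
    simp [loopRoot_succ_right, loopRoot_succ_left, loopRoot_self]

/-- The real root vectors of degree `k δ + α₁` in the affine Lie algebra. -/
noncomputable def rootE : ℕ → AffineSl2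
  | 0 => chevalleyE 1
  | k + 1 => (2⁻¹ : ℂ) • ⁅⁅chevalleyE 1, chevalleyE 0⁆, rootE k⁆

/-- The real root vectors of degree `k δ + α₀` in the affine Lie algebra. -/
noncomputable def rootF : ℕ → AffineSl2
  | 0 => chevalleyE 0
  | k + 1 => (-2⁻¹ : ℂ) • ⁅⁅chevalleyE 1, chevalleyE 0⁆, rootF k⁆

/-- The factor `2⁻¹` in `rootE` cancels the eigenvalue `2` of `ad h`, so no scalar appears. -/
theorem loopHom_rootE (k : ℕ) : loopHom (rootE k) = loopRoot (k + 1) k := by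
  induction k with
  | zero => exact loopHom_chevalleyE_one
  | succ k ih =>
    rw [rootE, map_smul, LieHom.map_lie, LieHom.map_lie, ih, loopHom_chevalleyE_one,
      loopHom_chevalleyE_zero, loopRoot_lie_simple, loopRoot_lie_self_left, smul_smul,
      inv_mul_cancel₀ two_ne_zero, one_smul, add_comm 1 k]

theorem loopHom_rootF (k : ℕ) : loopHom (rootF k) = loopRoot k (k + 1) := by
  induction k with
  | zero => exact loopHom_chevalleyE_zero
  | succ k ih =>
    rw [rootF, map_smul, LieHom.map_lie, LieHom.map_lie, ih, loopHom_chevalleyE_one,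
      loopHom_chevalleyE_zero, loopRoot_lie_simple, loopRoot_lie_self_right, smul_smul,
      neg_mul_neg, inv_mul_cancel₀ two_ne_zero, one_smul, add_comm 1 k]

theorem loopHom_rootH (k : ℕ) :
    loopHom ⁅rootE k, rootF 0⁆ = loopRoot (k + 1) (k + 1) := by
  rw [LieHom.map_lie, loopHom_rootE, loopHom_rootF, loopRoot_lie_left_right, add_zero]

/-- The images sit in pairwise distinct degrees, and the forms `loopCoeff` are a dual family. -/
theorem linearIndependent_loopHom_rootVectors :
    LinearIndependent ℂ (fun s => loopHom
      ((Sum.elim rootE (Sum.elim rootF fun n => ⁅rootE n, rootF 0⁆) : ℕ ⊕ ℕ ⊕ ℕ → AffineSl2) s)) := by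
  refine LinearIndependent.of_pairwise_dual_eq_zero_one _ (Sum.elim (fun k => loopCoeff (k + 1) k)
    (Sum.elim (fun k => loopCoeff k (k + 1)) fun k => loopCoeff (k + 1) (k + 1))) ?_ ?_
  · rintro (i | i | i) (j | j | j) hij <;>
      simp only [Sum.elim_inl, Sum.elim_inr, loopHom_rootE, loopHom_rootF, loopHom_rootH] <;>
      refine loopCoeff_loopRoot_ne (by omega) ?_ <;> simp at hij ⊢ <;> omega
  · rintro (i | i | i) <;>
      simp only [Sum.elim_inl, Sum.elim_inr, loopHom_rootE, loopHom_rootF, loopHom_rootH] <;>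
      exact loopCoeff_loopRoot_self (by omega)

/-- The positive subalgebra embeds into the loop algebra. -/
theorem eq_zero_of_loopHom_eq_zero {x : AffineSl2} (hx : x ∈ nPlus) (h : loopHom x = 0) :
    x = 0 := by
  have hE : ∀ k, ⁅⁅rootE 0, rootF 0⁆, rootE k⁆ = (2 : ℂ) • rootE (k + 1) := by
    intro k
    rw [rootE.eq_2, smul_smul, mul_inv_cancel₀ two_ne_zero, one_smul]
    rfl
  have hF : ∀ k, ⁅⁅rootE 0, rootF 0⁆, rootF k⁆ = (-2 : ℂ) • rootF (k + 1) := by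
    intro k
    rw [rootF.eq_2, smul_smul, neg_mul_neg, mul_inv_cancel₀ two_ne_zero, one_smul]
    rfl
  have hx' : x ∈ LieSubalgebra.lieSpan ℂ AffineSl2 {rootE 0, rootF 0} := by
    refine LieSubalgebra.lieSpan_mono ?_ hx
    rintro _ ⟨i, rfl⟩
    fin_cases i
    exacts [Or.inr rfl, Or.inl rfl]
  have key := lieSpan_le_span_rootVectors rootE rootF hE hF (chevalleyE_serre 1 0 (by decide))
    (chevalleyE_serre 0 1 (by decide)) hx'
  obtain ⟨c, rfl⟩ := (Finsupp.mem_span_range_iff_exists_finsupp).1 key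
  -- The spanning vectors have independent images, so a combination with zero image has zero
  -- coefficients.
  have hc : c = 0 := by
    refine (linearIndependent_iff.1 linearIndependent_loopHom_rootVectors) c ?_
    rw [← h, Finsupp.linearCombination_apply, Finsupp.sum, Finsupp.sum]
    rw [← LieHom.coe_toLinearMap, map_sum]
    simp
  simp [hc]

end LoopAlgebra

/-! ### Lyndon words and the costandard factorization -/

section LyndonWords

variable {I : Type*} [LinearOrder I]

/-- Without a prefix relation the comparison is decided at a letter present in both words, so tails
do not matter. -/
theorem append_lt_append_of_not_prefix {u v : List I} (h : u < v) (hp : ¬ u <+: v)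
    (x y : List I) : u ++ x < v ++ y := by
  induction u generalizing v with
  | nil => exact absurd List.nil_prefix hp
  | cons a u ih =>
    cases v with
    | nil => simp at h
    | cons b v =>
      rw [List.cons_append, List.cons_append, List.cons_lt_cons_iff]
      rw [List.cons_lt_cons_iff] at h
      rcases h with h | ⟨rfl, h⟩
      · exact Or.inl h
      · exact Or.inr ⟨rfl, ih h fun hp' => hp (by simpa using hp')⟩

theorem append_lt_append_left_iff (u : List I) {s t : List I} : u ++ s < u ++ t ↔ s < t := by
  induction u with
  | nil => rfl
  | cons a u ih => simp [ih]

theorem lt_append_of_ne_nil (u : List I) {t : List I} (ht : t ≠ []) : u < u ++ t := by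
  obtain ⟨x, t, rfl⟩ := List.exists_cons_of_ne_nil ht
  have := (append_lt_append_left_iff u (s := []) (t := x :: t)).2 (List.nil_lt_cons x t)
  simpa using this

theorem append_lt_append_of_lt_of_length_eq {u v : List I} (h : u < v)
    (hl : v.length ≤ u.length) (x y : List I) : u ++ x < v ++ y := by
  refine append_lt_append_of_not_prefix h (fun hp => ?_) x y
  exact absurd h (by rw [hp.eq_of_length_le hl]; exact lt_irrefl v)

theorem append_le_append_of_length_eq {u v x y : List I} (h : u ≤ v) (hl : u.length = v.length)
    (hxy : x ≤ y) : u ++ x ≤ v ++ y := by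
  rcases h.lt_or_eq with h | rfl
  · exact (append_lt_append_of_lt_of_length_eq h hl.ge x y).le
  · rcases hxy.lt_or_eq with hxy | rfl
    · exact ((append_lt_append_left_iff u).2 hxy).le
    · exact le_rfl

/-- A word is Lyndon if and only if it is smaller than all of its proper suffixes. -/
theorem isLyndon_iff_lt_suffix {w : List I} :
    IsLyndon w ↔ w ≠ [] ∧ ∀ u v : List I, u ≠ [] → v ≠ [] → w = u ++ v → w < v := by
  refine ⟨fun hw => ⟨hw.1, fun u v hu hv h => ?_⟩, fun hw => ⟨hw.1, fun u v hu hv h => ?_⟩⟩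
  · have h1 := hw.2 u v hu hv h
    by_contra hle
    have hne : v ≠ w := by
      rintro rfl
      exact hu (by simpa using h)
    have hlt : v < w := lt_of_le_of_ne (not_lt.1 hle) hne
    -- If `w = uv = vt`, then `w < vu` gives `t < u`, hence `tv < uv = w` as `t` and `u` have equal
    -- length; this contradicts minimality of `w` among its rotations.
    by_cases hp : v <+: w
    · obtain ⟨t, ht⟩ := hp
      have ht0 : t ≠ [] := by
        rintro rfl
        exact hne (by simpa using ht)
      have hl : t.length = u.length := by
        have := congrArg List.length (ht.trans h)
        simp at this
        omega
      have h2 : t < u := by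
        rw [← ht] at h1
        exact (append_lt_append_left_iff v).1 h1
      have h3 := hw.2 v t hv ht0 ht.symm
      have h4 := append_lt_append_of_lt_of_length_eq h2 hl.ge v v
      rw [← h] at h4
      exact lt_asymm h3 h4
    · have := append_lt_append_of_not_prefix hlt hp u []
      rw [List.append_nil] at this
      exact lt_asymm h1 this
  · exact (hw.2 u v hu hv h).trans (lt_append_of_ne_nil v hu)

theorem IsLyndon.lt_of_eq_append {w u v : List I} (hw : IsLyndon w) (hu : u ≠ []) (hv : v ≠ [])
    (h : w = u ++ v) : w < v :=
  (isLyndon_iff_lt_suffix.1 hw).2 u v hu hv h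

/-- First `sv < v`. A proper suffix of `sv` is then either a suffix of `v`, or `cv` with `c` a
proper suffix of `s`; in that case `s < c` is decided before `c` ends. -/
theorem IsLyndon.append {s v : List I} (hs : IsLyndon s) (hv : IsLyndon v) (h : s < v) :
    IsLyndon (s ++ v) := by
  have hsv : s ++ v < v := by
    by_cases hp : s <+: v
    · obtain ⟨t, rfl⟩ := hp
      have ht : t ≠ [] := by
        rintro rfl
        simp at h
      exact (append_lt_append_left_iff s).2 (hv.lt_of_eq_append hs.1 ht rfl)
    · simpa using append_lt_append_of_not_prefix h hp v []
  refine isLyndon_iff_lt_suffix.2 ⟨by simp [hs.1], fun a b ha hb hab => ?_⟩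
  rcases List.append_eq_append_iff.1 hab with ⟨c, rfl, hc⟩ | ⟨c, hc, rfl⟩
  · rcases eq_or_ne c [] with rfl | hc0
    · rw [List.nil_append] at hc
      exact hc ▸ hsv
    · exact hsv.trans (hv.lt_of_eq_append hc0 hb hc)
  · rcases eq_or_ne c [] with rfl | hc0
    · exact hsv
    · refine append_lt_append_of_lt_of_length_eq (hs.lt_of_eq_append ha hc0 hc) ?_ v v
      rw [hc]
      simp

/-- A word that is not Lyndon has a proper suffix not exceeding it; descend on the length. -/
theorem exists_isLyndon_suffix_le (u : List I) (hu : u ≠ []) :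
    ∃ r s, u = r ++ s ∧ IsLyndon s ∧ s ≤ u := by
  by_cases h : IsLyndon u
  · exact ⟨[], u, rfl, h, le_rfl⟩
  · rw [isLyndon_iff_lt_suffix] at h
    push Not at h
    obtain ⟨x, y, hx, hy, hxy, hle⟩ := h hu
    obtain ⟨r, s, hrs, hs, hsy⟩ := exists_isLyndon_suffix_le y hy
    exact ⟨x ++ r, s, by rw [hxy, hrs, List.append_assoc], hs, hsy.trans hle⟩
termination_by u.length
decreasing_by
  have := List.length_pos_iff.2 hx
  rw [hxy, List.length_append]
  omega

/-- The left factor of the costandard factorization of a Lyndon word is Lyndon. -/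
theorem IsLyndon.take_costandardCut {w : List I} (hw : IsLyndon w) (hl : 2 ≤ w.length) :
    IsLyndon (w.take (costandardCut w hl)) := by
  obtain ⟨h0, h1, hv⟩ := costandardCut_spec w hl
  have hmin := costandardCut_le w hl
  set a := costandardCut w hl
  -- Otherwise the left factor has a proper Lyndon suffix `s` below the right factor. Prepending `s`
  -- to the right factor yields a longer proper Lyndon suffix of `w`.
  by_contra hu
  have hu0 : w.take a ≠ [] := by
    rw [← List.length_pos_iff, List.length_take]
    omega
  obtain ⟨r, s, hrs, hs, hle⟩ := exists_isLyndon_suffix_le (w.take a) hu0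
  have hr : r ≠ [] := by
    rintro rfl
    rw [List.nil_append] at hrs
    exact hu (hrs ▸ hs)
  have hw' : w = w.take a ++ w.drop a := (List.take_append_drop a w).symm
  have h2 : w.take a < w := by
    conv_rhs => rw [hw']
    exact lt_append_of_ne_nil _ hv.1
  have h3 : s < w.drop a := hle.trans_lt (h2.trans (hw.lt_of_eq_append hu0 hv.1 hw'))
  have hdrop : w.drop r.length = s ++ w.drop a := by
    conv_lhs => rw [hw', hrs, List.append_assoc, List.drop_left]
  have h4 := congrArg List.length hrs
  have h5 := List.length_pos_iff.2 hs.1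
  rw [List.length_take, List.length_append, min_eq_left h1.le] at h4
  have := hmin r.length ⟨List.length_pos_iff.2 hr, by omega, hdrop ▸ hs.append hv h3⟩
  omega

variable {L : Type*} [LieRing L]

theorem bracketing_of_two_le_length (e : I → L) (w : List I) (hw : 2 ≤ w.length) :
    bracketing e w =
      ⁅bracketing e (w.take (costandardCut w hw)), bracketing e (w.drop (costandardCut w hw))⁆ := by
  match w, hw with
  | i :: j :: t, hw => rw [bracketing]

theorem bracketing_singleton (e : I → L) (i : I) : bracketing e [i] = e i := by rw [bracketing]

/-- The standard bracketing of a concatenation whose right factor is the longest proper Lyndon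
suffix. -/
theorem bracketing_append (e : I → L) {u v : List I} (hu : u ≠ []) (hv : IsLyndon v)
    (h : ∀ x y, x ≠ [] → y ≠ [] → u = x ++ y → ¬ IsLyndon (y ++ v)) :
    bracketing e (u ++ v) = ⁅bracketing e u, bracketing e v⁆ := by
  have h1 := List.length_pos_iff.2 hu
  have h2 := List.length_pos_iff.2 hv.1
  have hw : 2 ≤ (u ++ v).length := by
    rw [List.length_append]
    omega
  have hcut : costandardCut (u ++ v) hw = u.length := by
    have hle := costandardCut_le (u ++ v) hw u.length
      ⟨h1, by rw [List.length_append]; omega, by rwa [List.drop_left]⟩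
    obtain ⟨h0, -, h3⟩ := costandardCut_spec (u ++ v) hw
    by_contra hne
    have hlt := lt_of_le_of_ne hle hne
    rw [List.drop_append_of_le_length hle] at h3
    refine h _ _ ?_ ?_ (List.take_append_drop (costandardCut (u ++ v) hw) u).symm h3
    · rw [← List.length_pos_iff, List.length_take]
      omega
    · rw [← List.length_pos_iff, List.length_drop]
      omega
  rw [bracketing_of_two_le_length e _ hw, hcut, List.take_left, List.drop_left]

end LyndonWords

/-! ### Combinatorics of the candidate words -/

section StandardWords

attribute [local instance] LieRing.ofAssociativeRing

theorem tens_zero : tens 0 = [] := rfl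

theorem tens_succ (k : ℕ) : tens (k + 1) = one :: zero :: tens k := by
  simp [tens, List.replicate_succ]

theorem tens_add (k m : ℕ) : tens (k + m) = tens k ++ tens m := by
  simp [tens, ← List.replicate_append_replicate]

theorem letter_eq (i : Letter) : i = one ∨ i = zero := by
  revert i; decide

theorem count_one_one_cons (w : List Letter) : (one :: w).count one = w.count one + 1 :=
  List.count_cons_self

theorem count_zero_zero_cons (w : List Letter) : (zero :: w).count zero = w.count zero + 1 :=
  List.count_cons_self

theorem count_one_zero_cons (w : List Letter) : (zero :: w).count one = w.count one :=
  List.count_cons_of_ne one_lt_zero.ne'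

theorem count_zero_one_cons (w : List Letter) : (one :: w).count zero = w.count zero :=
  List.count_cons_of_ne one_lt_zero.ne

theorem count_one_add_count_zero (w : List Letter) : w.count one + w.count zero = w.length := by
  induction w with
  | nil => rfl
  | cons i w ih =>
    rcases letter_eq i with rfl | rfl
    · rw [count_one_one_cons, count_zero_one_cons, List.length_cons]; omega
    · rw [count_one_zero_cons, count_zero_zero_cons, List.length_cons]; omega

theorem degree_eq_iff (w : List Letter) (α : Letter →₀ ℕ) :
    degree w = α ↔ w.count one = α one ∧ w.count zero = α zero := by
  have h : ∀ i, degree w i = w.count i := by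
    intro i
    induction w with
    | nil => simp [degree]
    | cons j w ih =>
      have : degree (j :: w) = Finsupp.single j 1 + degree w := by simp [degree]
      rw [this, Finsupp.add_apply, ih, List.count_cons, Finsupp.single_apply, add_comm]
      simp
  rw [← h, ← h, Finsupp.ext_iff]
  refine ⟨fun H => ⟨H _, H _⟩, fun H i => ?_⟩
  rcases letter_eq i with rfl | rfl
  exacts [H.1, H.2]

theorem count_one_tens (k : ℕ) : (tens k).count one = k := by
  induction k with
  | zero => rfl
  | succ k ih => rw [tens_succ, count_one_one_cons, count_one_zero_cons, ih]

theorem count_zero_tens (k : ℕ) : (tens k).count zero = k := by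
  induction k with
  | zero => rfl
  | succ k ih => rw [tens_succ, count_zero_one_cons, count_zero_zero_cons, ih]

theorem length_tens (k : ℕ) : (tens k).length = k + k := by
  rw [← count_one_add_count_zero, count_one_tens, count_zero_tens]

/-- This and the next two bounds exclude, by counting letters, that a word of a given degree is a
prefix of a candidate word; strict inequalities then survive appending. -/
theorem count_prefix_tens {u : List Letter} {k : ℕ} (h : u <+: tens k) :
    u.count zero ≤ u.count one := by
  induction k generalizing u with
  | zero =>
    rw [tens_zero, List.prefix_nil] at h
    subst h
    rfl
  | succ k ih =>
    rw [tens_succ, List.prefix_cons_iff] at h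
    rcases h with rfl | ⟨t, rfl, h⟩
    · rfl
    · rw [List.prefix_cons_iff] at h
      rcases h with rfl | ⟨s, rfl, h⟩
      · rw [count_one_one_cons, count_zero_one_cons]; simp
      · have := ih h
        rw [count_one_one_cons, count_zero_one_cons, count_one_zero_cons, count_zero_zero_cons]
        omega

theorem count_prefix_one_tens {u : List Letter} {k : ℕ} (hu : u ≠ [])
    (h : u <+: one :: tens k) : u.count zero < u.count one := by
  rw [List.prefix_cons_iff] at h
  rcases h with rfl | ⟨t, rfl, h⟩
  · exact absurd rfl hu
  · have := count_prefix_tens h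
    rw [count_one_one_cons, count_zero_one_cons]
    omega

theorem count_prefix_one_tens_zero {u : List Letter} {k : ℕ}
    (h : u <+: one :: tens k ++ [zero]) : u.count zero ≤ u.count one := by
  rw [List.prefix_concat_iff] at h
  rcases h with rfl | h
  · simp [count_zero_one_cons, count_one_tens, count_zero_tens,
      List.count_singleton]
  · rcases eq_or_ne u [] with rfl | hu
    · rfl
    · exact (count_prefix_one_tens hu h).le

theorem suffix_tens {x y : List Letter} {k : ℕ} (h : tens k = x ++ y) :
    ∃ j, y = tens j ∨ y = zero :: tens j := by
  induction k generalizing x with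
  | zero =>
    rw [tens_zero, eq_comm, List.append_eq_nil_iff] at h
    exact ⟨0, Or.inl h.2⟩
  | succ k ih =>
    match x, h with
    | [], h => exact ⟨k + 1, Or.inl h.symm⟩
    | [a], h =>
      rw [tens_succ] at h
      exact ⟨k, Or.inr (List.cons.inj h).2.symm⟩
    | a :: b :: x, h =>
      rw [tens_succ] at h
      exact ih (List.cons.inj (List.cons.inj h).2).2

/-- Equality holds for `k = 0`; otherwise the second letters decide. The words have equal length, so
one may replace the other at the front of a bound. -/
theorem one_tens_zero_le (k : ℕ) : one :: tens k ++ [zero] ≤ tens (k + 1) := by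
  cases k with
  | zero => exact le_rfl
  | succ k =>
    rw [tens_succ (k + 1), tens_succ]
    refine le_of_lt (List.cons_lt_cons_iff.2 (Or.inr ⟨rfl, ?_⟩))
    exact List.cons_lt_cons_iff.2 (Or.inl one_lt_zero)

/-- `p α₁ + q α₀` is a positive root. -/
def IsRoot (p q : ℕ) : Prop := p = q + 1 ∨ q = p + 1 ∨ (p = q ∧ 0 < p)

/-- The standard Lyndon word of degree `p α₁ + q α₀`, when this is a positive root. -/
def standardWord (p q : ℕ) : List Letter :=
  if p = q + 1 then one :: tens q else
  if q = p + 1 then tens p ++ [zero] else one :: tens (p - 1) ++ [zero]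

theorem standardWord_succ_left (k : ℕ) : standardWord (k + 1) k = one :: tens k := by
  simp [standardWord]

theorem standardWord_succ_right (k : ℕ) : standardWord k (k + 1) = tens k ++ [zero] := by
  rw [standardWord, if_neg (by omega), if_pos rfl]

theorem standardWord_self (k : ℕ) :
    standardWord (k + 1) (k + 1) = one :: tens k ++ [zero] := by
  simp [standardWord]

/-- Writing an imaginary root as `(k + 1)δ` removes the truncated subtraction in `standardWord`. -/
theorem IsRoot.cases {P : ∀ p q, IsRoot p q → Prop} (h1 : ∀ k, P (k + 1) k (Or.inl rfl))
    (h2 : ∀ k, P k (k + 1) (Or.inr (Or.inl rfl)))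
    (h3 : ∀ k, P (k + 1) (k + 1) (Or.inr (Or.inr ⟨rfl, k.succ_pos⟩))) {p q : ℕ}
    (h : IsRoot p q) : P p q h := by
  rcases h with rfl | rfl | ⟨rfl, h⟩
  · exact h1 _
  · exact h2 _
  · obtain ⟨k, rfl⟩ := Nat.exists_eq_succ_of_ne_zero h.ne'
    exact h3 k

theorem count_standardWord {p q : ℕ} (h : IsRoot p q) :
    (standardWord p q).count one = p ∧ (standardWord p q).count zero = q := by
  induction h using IsRoot.cases with
  | h1 k =>
    rw [standardWord_succ_left, count_one_one_cons, count_zero_one_cons, count_one_tens,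
      count_zero_tens]
    exact ⟨rfl, rfl⟩
  | h2 k =>
    rw [standardWord_succ_right, List.count_append, List.count_append, count_one_tens,
      count_zero_tens]
    exact ⟨rfl, rfl⟩
  | h3 k =>
    rw [standardWord_self, List.count_append, List.count_append, count_one_one_cons,
      count_zero_one_cons, count_one_tens, count_zero_tens]
    exact ⟨rfl, rfl⟩

/-- The concatenation of Lyndon words `u < v` bounded by the standard words of their degrees is
bounded by the standard word of its degree. -/
theorem append_le_standardWord {p q p' q' : ℕ} (h : IsRoot p q) (h' : IsRoot p' q')
    (hne : p + q' ≠ q + p') {u v : List Letter} (hu1 : u.count one = p) (hu0 : u.count zero = q)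
    (hu : u ≤ standardWord p q) (hv : v ≤ standardWord p' q') (huv : u < v) :
    u ++ v ≤ standardWord (p + p') (q + q') := by
  have hlen := count_one_add_count_zero u
  have hlen' := count_one_add_count_zero (standardWord p q)
  have hcount := count_standardWord h
  rw [hcount.1, hcount.2] at hlen'
  rw [hu1, hu0, hlen'] at hlen
  -- When the candidate words come in the favourable order, this bound suffices: real `α₁`-type
  -- before imaginary before real `α₀`-type. In the opposite order `huv'` is used instead: `u` is
  -- smaller than the second candidate and, by its letter counts, not a prefix of it. Equal types
  -- are excluded by `hne`.
  have hle := append_le_append_of_length_eq hu hlen.symm hv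
  have hu_ne : u ≠ [] := by
    rintro rfl
    rcases h with h | h | h <;> simp at hu1 hu0 <;> omega
  have huv' := huv.trans_le hv
  clear hlen hlen' hcount huv hv hu
  induction h using IsRoot.cases with
  | h1 k =>
    induction h' using IsRoot.cases with
    | h1 m => omega
    | h2 m =>
      rw [show k + 1 + m = k + m + 1 by omega, show k + (m + 1) = k + m + 1 by omega,
        standardWord_self, tens_add]
      rw [standardWord_succ_left, standardWord_succ_right] at hle
      simpa using hle
    | h3 m =>
      rw [show k + 1 + (m + 1) = k + (m + 1) + 1 by omega, standardWord_succ_left, tens_add]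
      rw [standardWord_succ_left, standardWord_self] at hle
      exact hle.trans (append_le_append_of_length_eq le_rfl rfl (one_tens_zero_le m))
  | h2 k =>
    induction h' using IsRoot.cases with
    | h1 m =>
      rw [show k + (m + 1) = m + k + 1 by omega, show k + 1 + m = m + k + 1 by omega,
        standardWord_self, tens_add]
      rw [standardWord_succ_left] at huv'
      refine le_of_lt ?_
      have := append_lt_append_of_not_prefix huv' (fun hp => ?_) v (tens k ++ [zero])
      · simpa using this
      · have := count_prefix_one_tens hu_ne hp
        omega
    | h2 m => omega
    | h3 m =>
      rw [show k + (m + 1) = m + 1 + k by omega, show k + 1 + (m + 1) = m + 1 + k + 1 by omega,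
        standardWord_succ_right, tens_add]
      rw [standardWord_self] at huv'
      refine le_of_lt ?_
      have := append_lt_append_of_not_prefix huv' (fun hp => ?_) v (tens k ++ [zero])
      · refine this.trans_le ?_
        rw [List.append_assoc (tens (m + 1))]
        refine append_le_append_of_length_eq (one_tens_zero_le m) ?_ le_rfl
        simp [length_tens]
        omega
      · have := count_prefix_one_tens_zero hp
        omega
  | h3 k =>
    induction h' using IsRoot.cases with
    | h1 m =>
      rw [show k + 1 + (m + 1) = m + (k + 1) + 1 by omega, show k + 1 + m = m + (k + 1) by omega,
        standardWord_succ_left, tens_add]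
      rw [standardWord_succ_left] at huv'
      refine le_of_lt ?_
      have := append_lt_append_of_not_prefix huv' (fun hp => ?_) v (tens (k + 1))
      · simpa using this
      · have := count_prefix_one_tens hu_ne hp
        omega
    | h2 m =>
      rw [show k + 1 + (m + 1) = k + 1 + m + 1 by omega, standardWord_succ_right, tens_add]
      rw [standardWord_self, standardWord_succ_right] at hle
      refine hle.trans ?_
      rw [List.append_assoc (tens (k + 1))]
      refine append_le_append_of_length_eq (one_tens_zero_le k) ?_ le_rfl
      simp [length_tens]
      omega
    | h3 m => omega

theorem isLyndon_one_zero : IsLyndon [one, zero] :=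
  (isLyndon_singleton one).append (isLyndon_singleton zero)
    (List.cons_lt_cons_iff.2 (Or.inl one_lt_zero))

theorem isLyndon_tens_zero (k : ℕ) : IsLyndon (tens k ++ [zero]) := by
  induction k with
  | zero => exact isLyndon_singleton zero
  | succ k ih =>
    rw [tens_succ]
    refine isLyndon_one_zero.append ih ?_
    cases k with
    | zero => exact List.cons_lt_cons_iff.2 (Or.inl one_lt_zero)
    | succ k =>
      rw [tens_succ]
      exact lt_append_of_ne_nil [one, zero] (t := tens k ++ [zero]) (by simp)

theorem isLyndon_one_tens_zero (k : ℕ) : IsLyndon (one :: tens k ++ [zero]) := by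
  refine (isLyndon_singleton one).append (isLyndon_tens_zero k) ?_
  cases k with
  | zero => exact List.cons_lt_cons_iff.2 (Or.inl one_lt_zero)
  | succ k =>
    rw [tens_succ]
    exact lt_append_of_ne_nil [one] (t := zero :: tens k ++ [zero]) (by simp)

theorem tens_succ_eq_append (k : ℕ) : tens (k + 1) = tens k ++ [one, zero] := tens_add k 1

theorem isLyndon_one_tens (k : ℕ) : IsLyndon (one :: tens k) := by
  induction k with
  | zero => exact isLyndon_singleton one
  | succ k ih =>
    rw [tens_succ_eq_append]
    refine ih.append isLyndon_one_zero ?_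
    cases k with
    | zero => exact lt_append_of_ne_nil [one] (t := [zero]) (by simp)
    | succ k =>
      rw [tens_succ]
      exact List.cons_lt_cons_iff.2 (Or.inr ⟨rfl, List.cons_lt_cons_iff.2 (Or.inl one_lt_zero)⟩)

theorem isLyndon_standardWord {p q : ℕ} (h : IsRoot p q) : IsLyndon (standardWord p q) := by
  induction h using IsRoot.cases with
  | h1 k => rw [standardWord_succ_left]; exact isLyndon_one_tens k
  | h2 k => rw [standardWord_succ_right]; exact isLyndon_tens_zero k
  | h3 k => rw [standardWord_self]; exact isLyndon_one_tens_zero k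

/-! ### Bracketings of the candidate words and the upper bound -/

/-- The image in the loop algebra of the standard bracketing of a word. -/
noncomputable def loopBracketing (w : List Letter) :
    Matrix (Fin 2) (Fin 2) (LaurentPolynomial ℂ) :=
  loopHom (bracketing gen w : nPlus)

theorem loopBracketing_one : loopBracketing [one] = loopRoot 1 0 := by
  rw [loopBracketing, bracketing_singleton]
  exact loopHom_chevalleyE_one

theorem loopBracketing_zero : loopBracketing [zero] = loopRoot 0 1 := by
  rw [loopBracketing, bracketing_singleton]
  exact loopHom_chevalleyE_zero

theorem loopBracketing_of_two_le_length (w : List Letter) (hw : 2 ≤ w.length) :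
    loopBracketing w = ⁅loopBracketing (w.take (costandardCut w hw)),
      loopBracketing (w.drop (costandardCut w hw))⁆ := by
  rw [loopBracketing, bracketing_of_two_le_length gen w hw, LieSubalgebra.coe_bracket,
    LieHom.map_lie]
  rfl

theorem loopBracketing_append {u v : List Letter} (hu : u ≠ []) (hv : IsLyndon v)
    (h : ∀ x y, x ≠ [] → y ≠ [] → u = x ++ y → ¬ IsLyndon (y ++ v)) :
    loopBracketing (u ++ v) = ⁅loopBracketing u, loopBracketing v⁆ := by
  rw [loopBracketing, bracketing_append gen hu hv h, LieSubalgebra.coe_bracket, LieHom.map_lie]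
  rfl

theorem loopBracketing_one_append {v : List Letter} (hv : IsLyndon v) :
    loopBracketing (one :: v) = ⁅loopRoot 1 0, loopBracketing v⁆ := by
  rw [← loopBracketing_one]
  refine loopBracketing_append (u := [one]) (by simp) hv fun x y hx hy hxy => ?_
  have h1 := congrArg List.length hxy
  have h2 := List.length_pos_iff.2 hx
  have h3 := List.length_pos_iff.2 hy
  simp at h1
  omega

theorem loopBracketing_one_zero : loopBracketing [one, zero] = loopRoot 1 1 := by
  rw [loopBracketing_one_append (isLyndon_singleton zero), loopBracketing_zero,
    loopRoot_lie_simple]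

/-- The costandard factorization splits off the first `10`: the only longer proper suffix starts and
ends with `0`, so it exceeds its own suffix `0`. -/
theorem loopBracketing_tens_zero (k : ℕ) :
    loopBracketing (tens k ++ [zero]) = (-2 : ℂ) ^ k • loopRoot k (k + 1) := by
  induction k with
  | zero =>
    rw [pow_zero, one_smul]
    exact loopBracketing_zero
  | succ k ih =>
    have h := loopBracketing_append (u := [one, zero]) (by simp) (isLyndon_tens_zero k)
      fun x y hx hy hxy hL => ?_
    · rw [ih, loopBracketing_one_zero, lie_smul, loopRoot_lie_self_right, smul_smul, ← pow_succ,
        add_comm 1 k] at h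
      rw [← h, tens_succ]
      rfl
    · obtain ⟨a, x, rfl⟩ := List.exists_cons_of_ne_nil hx
      obtain ⟨-, hxy⟩ := List.cons.inj hxy
      rcases x with - | ⟨b, x⟩
      · obtain rfl : [zero] = y := hxy
        have h1 := hL.lt_of_eq_append (u := zero :: tens k) (v := [zero]) (by simp) (by simp)
          (by simp)
        exact lt_asymm h1 (lt_append_of_ne_nil [zero] (t := tens k ++ [zero]) (by simp))
      · obtain ⟨-, hxy⟩ := List.cons.inj hxy
        exact hy (List.append_eq_nil_iff.1 hxy.symm).2

/-- The costandard factorization splits off the last `10`: a longer proper suffix starts with `0` or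
has `10` as a proper prefix, so it exceeds its suffix `10`. -/
theorem loopBracketing_one_tens (k : ℕ) :
    loopBracketing (one :: tens k) = (-2 : ℂ) ^ k • loopRoot (k + 1) k := by
  induction k with
  | zero =>
    rw [pow_zero, one_smul]
    exact loopBracketing_one
  | succ k ih =>
    have h := loopBracketing_append (u := one :: tens k) (by simp) isLyndon_one_zero
      fun x y hx hy hxy hL => ?_
    · rw [ih, loopBracketing_one_zero, smul_lie, ← lie_skew, loopRoot_lie_self_left, ← neg_smul,
        smul_smul, ← pow_succ, add_comm 1 k] at h
      rw [← h, tens_succ_eq_append]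
      rfl
    · have h1 := hL.lt_of_eq_append (v := [one, zero]) hy (by simp) rfl
      obtain ⟨a, x, rfl⟩ := List.exists_cons_of_ne_nil hx
      obtain ⟨j, rfl | rfl⟩ := suffix_tens (List.cons.inj hxy).2
      · cases j with
        | zero => exact hy rfl
        | succ j =>
          rw [tens_succ] at h1
          exact lt_asymm h1
            (lt_append_of_ne_nil [one, zero] (t := tens j ++ [one, zero]) (by simp))
      · exact lt_asymm h1 (List.cons_lt_cons_iff.2 (Or.inl one_lt_zero))

theorem loopBracketing_one_tens_zero (k : ℕ) :
    loopBracketing (one :: tens k ++ [zero]) = (-2 : ℂ) ^ k • loopRoot (k + 1) (k + 1) := by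
  have h := loopBracketing_one_append (isLyndon_tens_zero k)
  have h1 := loopRoot_lie_left_right 0 k
  rw [zero_add, zero_add] at h1
  rwa [loopBracketing_tens_zero, lie_smul, h1] at h

theorem exists_loopBracketing_standardWord {p q : ℕ} (h : IsRoot p q) :
    ∃ c : ℂ, c ≠ 0 ∧ loopBracketing (standardWord p q) = c • loopRoot p q := by
  have hc : ∀ k : ℕ, (-2 : ℂ) ^ k ≠ 0 := fun k => pow_ne_zero k (neg_ne_zero.2 two_ne_zero)
  induction h using IsRoot.cases with
  | h1 k => exact ⟨_, hc k, by rw [standardWord_succ_left, loopBracketing_one_tens]⟩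
  | h2 k => exact ⟨_, hc k, by rw [standardWord_succ_right, loopBracketing_tens_zero]⟩
  | h3 k => exact ⟨_, hc k, by rw [standardWord_self, loopBracketing_one_tens_zero]⟩

/-- Bracketings are homogeneous, and each degree of the loop algebra that occurs is spanned by one
root vector. -/
theorem exists_loopBracketing_eq_smul (w : List Letter) :
    ∃ c : ℂ, loopBracketing w = c • loopRoot (w.count one) (w.count zero) := by
  match hw : w with
  | [] => exact ⟨0, by rw [zero_smul, loopBracketing, bracketing]; exact map_zero loopHom⟩
  | [i] =>
    rcases letter_eq i with rfl | rfl
    · exact ⟨1, by rw [one_smul, loopBracketing_one]; rfl⟩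
    · exact ⟨1, by rw [one_smul, loopBracketing_zero]; rfl⟩
  | i :: j :: t =>
    rw [← hw]
    have hl : 2 ≤ w.length := by simp [hw]
    obtain ⟨h0, h1, -⟩ := costandardCut_spec w hl
    obtain ⟨c, hc⟩ := exists_loopBracketing_eq_smul (w.take (costandardCut w hl))
    obtain ⟨d, hd⟩ := exists_loopBracketing_eq_smul (w.drop (costandardCut w hl))
    obtain ⟨s, hs⟩ := (loopRoot_lie ((w.take (costandardCut w hl)).count one)
      ((w.take (costandardCut w hl)).count zero) ((w.drop (costandardCut w hl)).count one)
      ((w.drop (costandardCut w hl)).count zero)).1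
    rw [← List.count_append, ← List.count_append, List.take_append_drop] at hs
    exact ⟨c * (d * s), by
      rw [loopBracketing_of_two_le_length w hl, hc, hd, smul_lie, lie_smul, hs, smul_smul,
        smul_smul, mul_assoc]⟩
termination_by w.length
decreasing_by
  · rw [← hw, List.length_take]; omega
  · rw [← hw, List.length_drop]; omega

theorem isRoot_of_loopBracketing_ne_zero {w : List Letter} (hw : w ≠ [])
    (h : loopBracketing w ≠ 0) : IsRoot (w.count one) (w.count zero) := by
  obtain ⟨c, hc⟩ := exists_loopBracketing_eq_smul w
  have h1 := List.length_pos_iff.2 hw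
  have h2 := count_one_add_count_zero w
  by_contra hr
  simp only [IsRoot, not_or, not_and] at hr
  refine h ?_
  rw [hc, loopRoot_eq_zero hr.1 hr.2.1 (fun h3 => hr.2.2 h3 (by omega)), smul_zero]

/-- A Lyndon word with nonzero bracketing is bounded by the standard word of its degree. -/
theorem le_standardWord {w : List Letter} (hw : IsLyndon w) (h : loopBracketing w ≠ 0) :
    w ≤ standardWord (w.count one) (w.count zero) := by
  match hw' : w with
  | [] => exact absurd rfl hw.1
  | [i] => rcases letter_eq i with rfl | rfl <;> exact le_rfl
  | i :: j :: t =>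
    rw [← hw'] at h hw ⊢
    have hl : 2 ≤ w.length := by simp [hw']
    obtain ⟨h0, h1, hv⟩ := costandardCut_spec w hl
    have hu := hw.take_costandardCut hl
    have huv : w.take (costandardCut w hl) ++ w.drop (costandardCut w hl) = w :=
      List.take_append_drop _ w
    rw [loopBracketing_of_two_le_length w hl] at h
    have hu' : loopBracketing (w.take (costandardCut w hl)) ≠ 0 := by
      intro h0
      exact h (by rw [h0, zero_lie])
    have hv' : loopBracketing (w.drop (costandardCut w hl)) ≠ 0 := by
      intro h0
      exact h (by rw [h0, lie_zero])
    have hlt : w.take (costandardCut w hl) < w.drop (costandardCut w hl) := by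
      have := lt_append_of_ne_nil (w.take (costandardCut w hl)) hv.1
      rw [huv] at this
      exact this.trans (hw.lt_of_eq_append hu.1 hv.1 huv.symm)
    -- The nonvanishing bracket of root vectors forces the two factors to be of different types.
    have hne : ⁅loopRoot ((w.take (costandardCut w hl)).count one)
        ((w.take (costandardCut w hl)).count zero),
        loopRoot ((w.drop (costandardCut w hl)).count one)
        ((w.drop (costandardCut w hl)).count zero)⁆ ≠ 0 := by
      intro h0
      obtain ⟨c, hc⟩ := exists_loopBracketing_eq_smul (w.take (costandardCut w hl))
      obtain ⟨d, hd⟩ := exists_loopBracketing_eq_smul (w.drop (costandardCut w hl))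
      exact h (by rw [hc, hd, smul_lie, lie_smul, h0, smul_zero, smul_zero])
    have key := append_le_standardWord (isRoot_of_loopBracketing_ne_zero hu.1 hu')
      (isRoot_of_loopBracketing_ne_zero hv.1 hv') ((loopRoot_lie _ _ _ _).2 hne) rfl rfl
      (le_standardWord hu hu') (le_standardWord hv hv') hlt
    rwa [← List.count_append, ← List.count_append, huv] at key
termination_by w.length
decreasing_by
  · rw [← hw', List.length_take]; omega
  · rw [← hw', List.length_drop]; omega

/-- The form `loopCoeff p q` separates: a larger Lyndon word has another degree or, by
`le_standardWord`, zero image, whereas the candidate has nonzero coefficient. -/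
theorem isAffineStandardLyndon_standardWord {p q : ℕ} (h : IsRoot p q) :
    IsAffineStandardLyndon (standardWord p q) := by
  refine ⟨isLyndon_standardWord h, fun hmem => ?_⟩
  obtain ⟨c, hc, hcw⟩ := exists_loopBracketing_standardWord h
  have hr : p = q + 1 ∨ q = p + 1 ∨ p = q := by
    rcases h with h | h | h
    exacts [Or.inl h, Or.inr (Or.inl h), Or.inr (Or.inr h.1)]
  have hker : Submodule.span ℂ (bracketing gen '' {m | IsLyndon m ∧ standardWord p q < m}) ≤
      LinearMap.ker (loopCoeff p q ∘ₗ (loopHom : AffineSl2 →ₗ[ℂ] _) ∘ₗ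
        nPlus.toSubmodule.subtype) := by
    rw [Submodule.span_le]
    rintro _ ⟨m, ⟨hm, hlt⟩, rfl⟩
    change loopCoeff p q (loopBracketing m) = 0
    obtain ⟨d, hd⟩ := exists_loopBracketing_eq_smul m
    by_cases hpq : (p, q) = (m.count one, m.count zero)
    · obtain ⟨rfl, rfl⟩ := Prod.mk.inj hpq
      by_contra hne
      refine absurd (le_standardWord hm fun h0 => hne ?_) (not_le.2 hlt)
      rw [h0, map_zero]
    · rw [hd, map_smul, loopCoeff_loopRoot_ne hr hpq, smul_zero]
  have h0 : loopCoeff p q (loopBracketing (standardWord p q)) = 0 := hker hmem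
  rw [hcw, map_smul, loopCoeff_loopRoot_self hr, smul_eq_mul, mul_one] at h0
  exact hc h0

/-- For a standard Lyndon word strictly below the bound, `b[w]` would be a multiple of the
bracketing of the larger candidate of the same degree. Proportionality is checked in the loop
algebra and lifted by injectivity. -/
theorem isAffineStandardLyndon_iff (w : List Letter) :
    IsAffineStandardLyndon w ↔
      IsRoot (w.count one) (w.count zero) ∧ w = standardWord (w.count one) (w.count zero) := by
  refine ⟨fun ⟨hw, hmem⟩ => ?_, fun ⟨h, hw⟩ => ?_⟩
  · have h0 : loopBracketing w ≠ 0 := by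
      intro h0
      have := eq_zero_of_loopHom_eq_zero (bracketing gen w : nPlus).2 h0
      refine hmem ?_
      rw [show bracketing gen w = 0 from Subtype.ext this]
      exact Submodule.zero_mem _
    have hr := isRoot_of_loopBracketing_ne_zero hw.1 h0
    refine ⟨hr, (le_standardWord hw h0).eq_of_not_lt fun hlt => hmem ?_⟩
    obtain ⟨c, hc, hcw⟩ := exists_loopBracketing_standardWord hr
    obtain ⟨d, hd⟩ := exists_loopBracketing_eq_smul w
    have key : bracketing gen w =
        (d * c⁻¹) • bracketing gen (standardWord (w.count one) (w.count zero)) := by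
      rw [← sub_eq_zero]
      refine Subtype.ext (eq_zero_of_loopHom_eq_zero (Subtype.prop _) ?_)
      have : loopBracketing w -
          (d * c⁻¹) • loopBracketing (standardWord (w.count one) (w.count zero)) = 0 := by
        rw [hd, hcw, smul_smul, inv_mul_cancel_right₀ hc, sub_self]
      rw [← this, loopBracketing, loopBracketing, ← map_smul, ← map_sub]
      rfl
    rw [key]
    exact Submodule.smul_mem _ _ (Submodule.subset_span ⟨_, ⟨isLyndon_standardWord hr, hlt⟩, rfl⟩)
  · rw [hw]
    exact isAffineStandardLyndon_standardWord h

theorem slWords_eq {p q : ℕ} (h : IsRoot p q) {α : Letter →₀ ℕ} (h1 : α one = p)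
    (h0 : α zero = q) : slWords α = {standardWord p q} := by
  subst h1 h0
  ext w
  rw [slWords, Set.mem_ofPred_eq, degree_eq_iff, isAffineStandardLyndon_iff, Set.mem_singleton_iff]
  refine ⟨fun ⟨⟨_, hw⟩, h1, h0⟩ => by rwa [h1, h0] at hw, ?_⟩
  rintro rfl
  have hc := count_standardWord h
  rw [hc.1, hc.2]
  exact ⟨⟨h, rfl⟩, rfl, rfl⟩

theorem α₁_apply : α₁ one = 1 ∧ α₁ zero = 0 := by
  simp [α₁, one_lt_zero.ne]

theorem α₀_apply : α₀ one = 0 ∧ α₀ zero = 1 := by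
  simp [α₀, one_lt_zero.ne']

theorem δ_apply : δ one = 1 ∧ δ zero = 1 := by
  simp [δ, α₁_apply, α₀_apply]

end StandardWords

end AffineLyndon

/-! ### The classification -/

theorem mainTheorem2 :
    (∀ k : ℕ, 1 ≤ k →
      AffineLyndon.slWords (k • AffineLyndon.δ + AffineLyndon.α₁) =
          {[AffineLyndon.one] ++ AffineLyndon.tens k} ∧
      AffineLyndon.slWords (k • AffineLyndon.δ + AffineLyndon.α₀) =
          {AffineLyndon.tens k ++ [AffineLyndon.zero]} ∧
      AffineLyndon.slWords ((k + 1) • AffineLyndon.δ) =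
          {[AffineLyndon.one] ++ AffineLyndon.tens k ++ [AffineLyndon.zero]}) ∧
    AffineLyndon.slWords AffineLyndon.α₁ = {[AffineLyndon.one]} ∧
    AffineLyndon.slWords AffineLyndon.α₀ = {[AffineLyndon.zero]} ∧
    AffineLyndon.slWords AffineLyndon.δ = {[AffineLyndon.one, AffineLyndon.zero]} ∧
    {w : List AffineLyndon.Letter | AffineLyndon.IsAffineStandardLyndon w} =
      {w | (∃ k : ℕ, 1 ≤ k ∧
              (w = [AffineLyndon.one] ++ AffineLyndon.tens k ∨
               w = AffineLyndon.tens k ++ [AffineLyndon.zero] ∨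
               w = [AffineLyndon.one] ++ AffineLyndon.tens k ++ [AffineLyndon.zero])) ∨
            w = [AffineLyndon.one] ∨ w = [AffineLyndon.zero] ∨
            w = [AffineLyndon.one, AffineLyndon.zero]} := by
  open AffineLyndon in
  have root1 : ∀ k, IsRoot (k + 1) k := fun k => Or.inl rfl
  have root2 : ∀ k, IsRoot k (k + 1) := fun k => Or.inr (Or.inl rfl)
  have root3 : ∀ k, IsRoot (k + 1) (k + 1) := fun k => Or.inr (Or.inr ⟨rfl, k.succ_pos⟩)
  have std1 : ∀ k, IsAffineStandardLyndon (one :: tens k) := fun k =>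
    standardWord_succ_left k ▸ isAffineStandardLyndon_standardWord (root1 k)
  have std2 : ∀ k, IsAffineStandardLyndon (tens k ++ [zero]) := fun k =>
    standardWord_succ_right k ▸ isAffineStandardLyndon_standardWord (root2 k)
  have std3 : ∀ k, IsAffineStandardLyndon (one :: tens k ++ [zero]) := fun k =>
    standardWord_self k ▸ isAffineStandardLyndon_standardWord (root3 k)
  -- The roots `α₁`, `α₀`, `δ` are the members `k = 0` of the three families.
  refine ⟨fun k _ => ⟨?_, ?_, ?_⟩, slWords_eq (root1 0) α₁_apply.1 α₁_apply.2,
    slWords_eq (root2 0) α₀_apply.1 α₀_apply.2, slWords_eq (root3 0) δ_apply.1 δ_apply.2, ?_⟩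
  · rw [slWords_eq (root1 k) (by simp [δ_apply, α₁_apply]) (by simp [δ_apply, α₁_apply]),
      standardWord_succ_left]
    rfl
  · rw [slWords_eq (root2 k) (by simp [δ_apply, α₀_apply]) (by simp [δ_apply, α₀_apply]),
      standardWord_succ_right]
  · rw [slWords_eq (root3 k) (by simp [δ_apply]) (by simp [δ_apply]), standardWord_self]
    rfl
  · ext w
    rw [Set.mem_ofPred_eq, Set.mem_ofPred_eq]
    constructor
    · intro hw
      obtain ⟨h, hw⟩ := (isAffineStandardLyndon_iff w).1 hw
      generalize w.count one = p at h hw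
      generalize w.count zero = q at h hw
      rw [hw]
      clear hw
      induction h using IsRoot.cases with
      | h1 k =>
        rw [standardWord_succ_left]
        rcases k.eq_zero_or_pos with rfl | hk
        exacts [Or.inr (Or.inl rfl), Or.inl ⟨k, hk, Or.inl rfl⟩]
      | h2 k =>
        rw [standardWord_succ_right]
        rcases k.eq_zero_or_pos with rfl | hk
        exacts [Or.inr (Or.inr (Or.inl rfl)), Or.inl ⟨k, hk, Or.inr (Or.inl rfl)⟩]
      | h3 k =>
        rw [standardWord_self]
        rcases k.eq_zero_or_pos with rfl | hk
        exacts [Or.inr (Or.inr (Or.inr rfl)), Or.inl ⟨k, hk, Or.inr (Or.inr rfl)⟩]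
    · rintro (⟨k, -, rfl | rfl | rfl⟩ | rfl | rfl | rfl)
      exacts [std1 k, std2 k, std3 k, std1 0, std2 0, std3 0]
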